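/- Setting. Let $d,r,n,m$ be natural numbers. For $k\in[r]$ let $\pi_k\ge 0$ with $\sum_k\pi_k=1$, and let $\mathcal D_k$ be a probability law on $\mathbb R^d$ with mean $\mu_k$ that is sub-gaussian with parameter $\sigma_k>0$, i.e. $\mathbb E\,e^{\langle v,\,Y-\mu_k\rangle}\le e^{\sigma_k^2\|v\|^2/2}$ for all $v\in\mathbb R^d$ and $Y\sim\mathcal D_k$. The $n$ inliers are i.i.d. from the mixture: inlier $i$ has a random label $\phi_i$ with $\mathbb P(\phi_i=k)=\pi_k$, and given $\phi_i=k$ its observation $y_i$ has law $\mathcal D_k$. There are in addition $m$ outliers, which are arbitrary random points of $\mathbb R^d$ (possibly dependent on each other and on the inliers). Put $N=n+m$, $\mathcal C_k=\{i:\phi_i=k\}$, $n_k=|\mathcal C_k|$, $n_{\min}=\min_k n_k$, $\sigma_{\max}=\max_k\sigma_k$, $\Delta_{kl}=\|\mu_k-\mu_l\|_2$, $\Delta_0=8\sigma_{\max}\sqrt d$ and $\tilde c=\sqrt{10}/8$. A pair $(k,l)$ is weakly separated if $\Delta_{kl}<\Delta_0$ and well separated if $\Delta_{kl}\ge\Delta_0$.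 Let $$\Delta'=\max_{k\ne l}\{\Delta_{kl}:\Delta_{kl}<\Delta_0\},\qquad \tilde\Delta_{\min}=\min_{k\neq l}\{\Delta_{kl}:\Delta_{kl}\ge\Delta_0\},$$ where $\Delta'=0$ if no two distinct clusters are weakly separated, and where at least one pair of distinct clusters is assumed to be well separated. For $\theta>0$ let $K_{ij}=\exp\big(-\|y_i-y_j\|^2/(2\theta^2)\big)$ be the Gaussian kernel matrix of all $N$ points, and let $\hat X$ be an optimal solution of Robust-LP: maximize $\sum_{i,j}(K_{ij}-\gamma)X_{ij}$ over real $N\times N$ matrices with $0\le X_{ij}\le 1$ for all $i,j$. Let $\tilde X$ be the $N\times N$ matrix with $\tilde X_{ij}=1$ if $i,j$ are inliers with $i\in\mathcal C_k$, $j\in\mathcal C_l$ and either $k=l$ or $(k,l)$ weakly separated, and $\tilde X_{ij}=0$ otherwise. The subscript $\mathcal I$ denotes restriction to the inliers, and $\|A\|_1=\sum_{i,j}|A_{ij}|$. Proposition. There are universal constants $C,C',C''>0$ such that the following holds in this setting. Suppose that $\theta=\Theta(\tilde\Delta_{\min})$, i.e. $\kappa_1\tilde\Delta_{\min}\le\theta\le\kappa_2\tilde\Delta_{\min}$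 with some $\kappa_1,\kappa_2>0$ (on which the constants do not depend), that $$\gamma\in\Big(\exp\Big(-\frac{\tilde\Delta_{\min}^2}{4\theta^2}\Big),\ \exp\Big(-\frac{5\tilde\Delta_{\min}^2}{32\theta^2}\Big)\Big),$$ and that $\Delta'<\min\{\tilde c\,\tilde\Delta_{\min},\Delta_0\}$. Then, conditionally on any value of the labels $(\phi_i)_{i\le n}$ for which $n_{\min}>r$, with probability at least $1-2r/n_{\min}$ every optimal solution $\hat X$ satisfies $$\|\hat X_{\mathcal I}-\tilde X_{\mathcal I}\|_1\le C n^2\max\Big\{\exp\Big(-\frac{(\tilde\Delta_{\min}-\Delta'/\tilde c)^2}{64\sigma_{\max}^2}\Big),\frac{\log n_{\min}}{n_{\min}}\Big\}$$ and, if moreover $m<n$, $$\frac{\|\hat X-\tilde X\|_1}{\|\tilde X\|_1}\le C' r\exp\Big(-\frac{(\tilde\Delta_{\min}-\Delta'/\tilde c)^2}{64\sigma_{\max}^2}\Big)+C'' r\max\Big\{\frac{\log n_{\min}}{n_{\min}},\frac mn\Big\}.$$ -/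

import Mathlib

open MeasureTheory ProbabilityTheory

noncomputable section

namespace RobustClustering

/-- The data space `ℝ^d` with its Euclidean norm. -/
abbrev Pt (d : ℕ) : Type := EuclideanSpace ℝ (Fin d)

/-- A probability law on `ℝ^d` with mean `μ` that is sub-gaussian with parameter `ψ > 0`:
`E exp(⟨v, X - μ⟩) ≤ exp(ψ² ‖v‖² / 2)` for every `v`. -/
structure IsSubGaussianLaw {d : ℕ} (D : Measure (Pt d)) (μ : Pt d) (ψ : ℝ) : Prop where
  isProbabilityMeasure : IsProbabilityMeasure D
  param_pos : 0 < ψ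
  integrable : Integrable (fun x : Pt d => x) D
  mean_eq : ∫ x, x ∂D = μ
  integrable_exp : ∀ v : Pt d, Integrable (fun x => Real.exp (inner ℝ v (x - μ))) D
  mgf_le : ∀ v : Pt d,
    ∫ x, Real.exp (inner ℝ v (x - μ)) ∂D ≤ Real.exp (ψ ^ 2 * ‖v‖ ^ 2 / 2)

/-- A mixture of `r` sub-gaussian distributions on `ℝ^d`: mixing weights `π_k`, cluster means
`μ_k`, component laws `D_k` and sub-gaussian parameters `σ_k`. -/
structure SubGaussianMixture (d r : ℕ) where
  weight : Fin r → ℝ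
  center : Fin r → Pt d
  law : Fin r → Measure (Pt d)
  param : Fin r → ℝ
  weight_nonneg : ∀ k, 0 ≤ weight k
  weight_sum : ∑ k, weight k = 1
  subGaussian : ∀ k, IsSubGaussianLaw (law k) (center k) (param k)

namespace SubGaussianMixture

variable {d r : ℕ} (M : SubGaussianMixture d r)

/-- `σ_max = max_k σ_k`. -/
def sigmaMax : ℝ := ⨆ k, M.param k

/-- `Δ_kl = ‖μ_k - μ_l‖`. -/
def sep (k l : Fin r) : ℝ := ‖M.center k - M.center l‖

/-- The threshold `Δ₀ = 8 σ_max √d`. -/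
def sepThreshold : ℝ := 8 * M.sigmaMax * Real.sqrt d

/-- The pair `(k, l)` is weakly separated. -/
def Weak (k l : Fin r) : Prop := M.sep k l < M.sepThreshold

/-- `Δ' = max {Δ_kl : k ≠ l, Δ_kl < Δ₀}`; it is `0` if no two distinct clusters are weakly
separated. -/
def maxWeakSep : ℝ := sSup {s : ℝ | ∃ k l, k ≠ l ∧ M.sep k l < M.sepThreshold ∧ s = M.sep k l}

/-- `Δ̃_min = min {Δ_kl : k ≠ l, Δ_kl ≥ Δ₀}`, meaningful if there is such a pair. -/
def minWellSep : ℝ := sInf {s : ℝ | ∃ k l, k ≠ l ∧ M.sepThreshold ≤ M.sep k l ∧ s = M.sep k l}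

/-- The joint law of (label, observation) of one inlier: the label is `k` with probability
`π_k`, and given the label `k` the observation has law `D_k`. -/
def labelledLaw : Measure (Fin r × Pt d) :=
  ∑ k, ENNReal.ofReal (M.weight k) • (Measure.dirac k).prod (M.law k)

/-- `φ` and `y` are the labels and the observations of `n` i.i.d. inlier points drawn from the
mixture. -/
structure IsSample {Ω : Type*} [MeasurableSpace Ω] (P : Measure Ω) {n : ℕ}
    (φ : Fin n → Ω → Fin r) (y : Fin n → Ω → Pt d) : Prop where
  measurable_label : ∀ i, Measurable (φ i)
  measurable_point : ∀ i, Measurable (y i)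
  indep : iIndepFun (fun i ω => (φ i ω, y i ω)) P
  law_eq : ∀ i, P.map (fun ω => (φ i ω, y i ω)) = M.labelledLaw

open Classical in
/-- The matrix `X̃` for the inlier labels `c` and `m` outliers: the entry is `1` if both points are
inliers whose clusters are equal or weakly separated, and `0` otherwise. -/
def mergedMatrix {n : ℕ} (m : ℕ) (c : Fin n → Fin r) :
    Matrix (Fin n ⊕ Fin m) (Fin n ⊕ Fin m) ℝ
  | Sum.inl i, Sum.inl j => if c i = c j ∨ M.Weak (c i) (c j) then 1 else 0
  | _, _ => 0

end SubGaussianMixture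

/-- `n_k`, the number of inliers with label `k`. -/
def clusterSize {n r : ℕ} (c : Fin n → Fin r) (k : Fin r) : ℕ :=
  (Finset.univ.filter (fun i => c i = k)).card

/-- `n_min = min_k n_k`. -/
def minClusterSize {n r : ℕ} (c : Fin n → Fin r) : ℕ := ⨅ k, clusterSize c k

/-- The Gaussian kernel matrix `K_ij = exp(-‖y_i - y_j‖² / (2 θ²))`. -/
def kernelMatrix {ι : Type*} {d : ℕ} (θ : ℝ) (y : ι → Pt d) : Matrix ι ι ℝ :=
  fun i j => Real.exp (-‖y i - y j‖ ^ 2 / (2 * θ ^ 2))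

/-- `X` is an optimal solution of Robust-LP:
maximize `⟨K - γ E, X⟩` subject to `0 ≤ X_ij ≤ 1`. -/
def IsRobustLPSolution {ι : Type*} [Fintype ι] (K : Matrix ι ι ℝ) (γ : ℝ)
    (X : Matrix ι ι ℝ) : Prop :=
  (∀ i j, 0 ≤ X i j ∧ X i j ≤ 1) ∧
    ∀ X' : Matrix ι ι ℝ, (∀ i j, 0 ≤ X' i j ∧ X' i j ≤ 1) →
      ∑ i, ∑ j, (K i j - γ) * X' i j ≤ ∑ i, ∑ j, (K i j - γ) * X i j

/-- The entrywise norm `‖A‖₁ = ∑_ij |A_ij|`. -/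
def l1Norm {ι : Type*} [Fintype ι] (A : Matrix ι ι ℝ) : ℝ := ∑ i, ∑ j, |A i j|

/-- The part of a matrix indexed by the inliers. -/
def inlierPart {n m : ℕ} (A : Matrix (Fin n ⊕ Fin m) (Fin n ⊕ Fin m) ℝ) :
    Matrix (Fin n) (Fin n) ℝ := A.submatrix Sum.inl Sum.inl

/-- The constant `c̃ = √10 / 8`. -/
def cTilde : ℝ := Real.sqrt 10 / 8

/-- `exp(-(Δ̃_min - Δ'/c̃)² / (64 σ_max²))`. -/
def SubGaussianMixture.errorRate {d r : ℕ} (M : SubGaussianMixture d r) : ℝ :=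
  Real.exp (-(M.minWellSep - M.maxWeakSep / cTilde) ^ 2 / (64 * M.sigmaMax ^ 2))

end RobustClustering

end

/-! The box constraint makes Robust-LP separate over entries: an optimal `X` is 1 where the kernel
exceeds `γ` and 0 where it is below. The window for `γ` turns this into thresholds on distances, so
an inlier entry can differ from `X̃` only if its pair is atypical: merged clusters but squared
distance at least `5Δ̃²/16`, or separate clusters but distance at most `3Δ̃/4`, where `Δ̃` is
`minWellSep`. Outliers do not affect inlier entries.

Given the labels, the points stay independent with laws `D_{c i}`, and a pair is atypical with
probability at most `p = errorRate`. For merged clusters this is a Chernoff bound for the squared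
norm of a sub-gaussian vector (`measure_sq_norm_ge_le`); for separate ones, a Chernoff bound along
the difference of the means (`measure_norm_le_le`).

Indicators of pairs sharing a point are dependent. Hoeffding's device splits the pairs `i < j` into
`n` matchings, independent within each, and Jensen averages over the matchings:
`measure_pair_count_ge_le` bounds the count by `2n²p + na` outside probability `exp(-a)`. Taking `a
= log n_min` gives the inlier bound. The relative bound adds the outlier blocks and uses `n² ≤ r
‖X̃‖₁`. -/

namespace RobustClustering

/-! ### Gaussian integrals with a linear term -/

section Gaussian

variable {d : ℕ}

theorem integrable_exp_neg_mul_sq_norm_add_inner {b : ℝ} (hb : 0 < b) (w : Pt d) :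
    Integrable (fun x : Pt d => Real.exp (-b * ‖x‖ ^ 2 + inner ℝ w x)) := by
  have h := (GaussianFourier.integrable_cexp_neg_mul_sq_norm_add
    (show 0 < (b : ℂ).re from hb) 1 w).re
  refine h.congr (ae_of_all _ fun x => ?_)
  have : (-(b : ℂ) * (‖x‖ : ℂ) ^ 2 + 1 * ((inner ℝ w x : ℝ) : ℂ))
      = ((-b * ‖x‖ ^ 2 + inner ℝ w x : ℝ) : ℂ) := by push_cast; ring
  simp only [this]
  exact Complex.exp_ofReal_re _

theorem integral_exp_neg_mul_sq_norm_add_inner {b : ℝ} (hb : 0 < b) (w : Pt d) :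
    ∫ x : Pt d, Real.exp (-b * ‖x‖ ^ 2 + inner ℝ w x)
      = (Real.pi / b) ^ ((d : ℝ) / 2) * Real.exp (‖w‖ ^ 2 / (4 * b)) := by
  have h := GaussianFourier.integral_cexp_neg_mul_sq_norm_add
    (show 0 < (b : ℂ).re from hb) 1 w
  have e : ∀ x : Pt d, Complex.exp (-(b : ℂ) * (‖x‖ : ℂ) ^ 2 + 1 * ((inner ℝ w x : ℝ) : ℂ))
      = ((Real.exp (-b * ‖x‖ ^ 2 + inner ℝ w x) : ℝ) : ℂ) := fun x => by push_cast; ring_nf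
  rw [integral_congr_ae (ae_of_all _ e), integral_complex_ofReal] at h
  apply Complex.ofReal_injective
  rw [h, finrank_euclideanSpace_fin, Complex.ofReal_mul, Complex.ofReal_exp,
    Complex.ofReal_cpow (by positivity)]
  push_cast
  ring_nf

theorem lintegral_exp_neg_mul_sq_norm_add_inner {b : ℝ} (hb : 0 < b) (w : Pt d) :
    ∫⁻ x : Pt d, ENNReal.ofReal (Real.exp (-b * ‖x‖ ^ 2 + inner ℝ w x))
      = ENNReal.ofReal ((Real.pi / b) ^ ((d : ℝ) / 2) * Real.exp (‖w‖ ^ 2 / (4 * b))) := by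
  rw [← integral_exp_neg_mul_sq_norm_add_inner hb w,
    ofReal_integral_eq_lintegral_ofReal (integrable_exp_neg_mul_sq_norm_add_inner hb w)
      (ae_of_all _ fun _ => (Real.exp_pos _).le)]

end Gaussian

/-! ### Tails of the norm of a sub-gaussian vector -/

section Tails

variable {d : ℕ} {Ω : Type*} [MeasurableSpace Ω] {Q : Measure Ω} [IsProbabilityMeasure Q]
  {Z : Ω → Pt d} {δ : Pt d} {σ : ℝ}

/-- The exponential moment of the squared norm of a vector whose deviation from `δ` is
sub-gaussian. -/
theorem lintegral_exp_sq_norm_le (hZ : Measurable Z) (hσ : 0 < σ)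
    (hsub : ∀ v : Pt d, ∫⁻ ω, ENNReal.ofReal (Real.exp (inner ℝ v (Z ω - δ))) ∂Q
      ≤ ENNReal.ofReal (Real.exp (σ ^ 2 * ‖v‖ ^ 2))) :
    ∫⁻ ω, ENNReal.ofReal (Real.exp (‖Z ω‖ ^ 2 / (16 * σ ^ 2))) ∂Q
      ≤ ENNReal.ofReal (Real.exp (d / 6 + ‖δ‖ ^ 2 / (12 * σ ^ 2))) := by
  -- Integrating `exp⟨Z, x⟩` against a Gaussian weight of rate `4σ²` produces `exp(‖Z‖²/(16σ²))` up
  -- to the factor `c`. After Tonelli, the moment bound costs `σ²‖x‖²`, leaving the integrable rate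
  -- `3σ²`.
  have hb : 0 < 4 * σ ^ 2 := by positivity
  have hb' : 0 < 3 * σ ^ 2 := by positivity
  set c : ℝ := (Real.pi / (4 * σ ^ 2)) ^ ((d : ℝ) / 2) with hc
  have hcpos : 0 < c := by positivity
  have hc0 : ENNReal.ofReal c ≠ 0 := by simpa using hcpos
  rw [← ENNReal.mul_le_mul_iff_right hc0 ENNReal.ofReal_ne_top]
  calc ENNReal.ofReal c * ∫⁻ ω, ENNReal.ofReal (Real.exp (‖Z ω‖ ^ 2 / (16 * σ ^ 2))) ∂Q
      = ∫⁻ ω, (∫⁻ x : Pt d, ENNReal.ofReal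
          (Real.exp (-(4 * σ ^ 2) * ‖x‖ ^ 2 + inner ℝ (Z ω) x))) ∂Q := by
        rw [← lintegral_const_mul _ (by fun_prop)]
        refine lintegral_congr fun ω => ?_
        rw [lintegral_exp_neg_mul_sq_norm_add_inner hb, ← ENNReal.ofReal_mul hcpos.le, hc]
        ring_nf
    _ = ∫⁻ x : Pt d, (∫⁻ ω, ENNReal.ofReal
          (Real.exp (-(4 * σ ^ 2) * ‖x‖ ^ 2 + inner ℝ (Z ω) x)) ∂Q) := by
        refine lintegral_lintegral_swap (Measurable.aemeasurable ?_)
        have := hZ.comp (measurable_fst : Measurable (Prod.fst : Ω × Pt d → Ω))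
        simp only [Function.uncurry_def]
        exact (((measurable_snd.norm.pow_const 2).const_mul _).add
          (this.inner measurable_snd)).exp.ennreal_ofReal
    _ ≤ ∫⁻ x : Pt d, ENNReal.ofReal (Real.exp (-(3 * σ ^ 2) * ‖x‖ ^ 2 + inner ℝ δ x)) := by
        refine lintegral_mono fun x => ?_
        have h1 : ∀ ω, ENNReal.ofReal (Real.exp (-(4 * σ ^ 2) * ‖x‖ ^ 2 + inner ℝ (Z ω) x))
            = ENNReal.ofReal (Real.exp (-(4 * σ ^ 2) * ‖x‖ ^ 2 + inner ℝ δ x))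
              * ENNReal.ofReal (Real.exp (inner ℝ x (Z ω - δ))) := fun ω => by
          rw [← ENNReal.ofReal_mul (Real.exp_pos _).le, ← Real.exp_add, inner_sub_right,
            real_inner_comm x (Z ω), real_inner_comm x δ]
          ring_nf
        simp only [h1]
        rw [lintegral_const_mul _ (by fun_prop)]
        refine (mul_le_mul_right (hsub x) _).trans_eq ?_
        rw [← ENNReal.ofReal_mul (Real.exp_pos _).le, ← Real.exp_add]
        ring_nf
    _ = ENNReal.ofReal ((Real.pi / (3 * σ ^ 2)) ^ ((d : ℝ) / 2)
          * Real.exp (‖δ‖ ^ 2 / (12 * σ ^ 2))) := by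
        rw [lintegral_exp_neg_mul_sq_norm_add_inner hb']
        ring_nf
    _ ≤ ENNReal.ofReal (c * Real.exp (d / 6 + ‖δ‖ ^ 2 / (12 * σ ^ 2))) := by
        refine ENNReal.ofReal_le_ofReal ?_
        rw [Real.exp_add, ← mul_assoc]
        refine mul_le_mul_of_nonneg_right ?_ (Real.exp_pos _).le
        -- The ratio of the normalisations is `(4/3)^(d/2)`, which is the source of `d/6`.
        have h43 : Real.pi / (3 * σ ^ 2) = Real.pi / (4 * σ ^ 2) * (4 / 3) := by
          field_simp
        rw [h43, Real.mul_rpow (by positivity) (by norm_num)]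
        refine mul_le_mul_of_nonneg_left ?_ hcpos.le
        have : (4 / 3 : ℝ) ≤ Real.exp (1 / 3) := by
          have := Real.add_one_le_exp (1 / 3 : ℝ); linarith
        calc (4 / 3 : ℝ) ^ ((d : ℝ) / 2) ≤ (Real.exp (1 / 3)) ^ ((d : ℝ) / 2) :=
              Real.rpow_le_rpow (by norm_num) this (by positivity)
          _ = Real.exp (d / 6) := by rw [← Real.exp_mul]; ring_nf
    _ = ENNReal.ofReal c * ENNReal.ofReal (Real.exp (d / 6 + ‖δ‖ ^ 2 / (12 * σ ^ 2))) :=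
        ENNReal.ofReal_mul hcpos.le

omit [IsProbabilityMeasure Q] in
theorem measure_le_of_lintegral_exp_le {f : Ω → ℝ} (hf : Measurable f) {a b : ℝ}
    (h : ∫⁻ ω, ENNReal.ofReal (Real.exp (f ω)) ∂Q ≤ ENNReal.ofReal (Real.exp b)) :
    Q {ω | a ≤ f ω} ≤ ENNReal.ofReal (Real.exp (b - a)) := by
  have h1 := mul_meas_ge_le_lintegral (μ := Q) (hf.exp.ennreal_ofReal)
    (ENNReal.ofReal (Real.exp a))
  have h2 : {ω | a ≤ f ω}
      = {ω | ENNReal.ofReal (Real.exp a) ≤ ENNReal.ofReal (Real.exp (f ω))} := by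
    ext ω
    simp [ENNReal.ofReal_le_ofReal_iff (Real.exp_pos _).le]
  rw [h2, Real.exp_sub, ENNReal.ofReal_div_of_pos (Real.exp_pos _),
    ENNReal.le_div_iff_mul_le (by simp [Real.exp_pos]) (by simp), mul_comm]
  exact h1.trans h

theorem measure_sq_norm_ge_le (hZ : Measurable Z) (hσ : 0 < σ)
    (hsub : ∀ v : Pt d, ∫⁻ ω, ENNReal.ofReal (Real.exp (inner ℝ v (Z ω - δ))) ∂Q
      ≤ ENNReal.ofReal (Real.exp (σ ^ 2 * ‖v‖ ^ 2)))
    {D w : ℝ} (hD : 8 * σ * Real.sqrt d ≤ D) (hδ : ‖δ‖ ≤ w) (hw : w ≤ cTilde * D) :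
    Q {ω | 5 * D ^ 2 / 16 ≤ ‖Z ω‖ ^ 2}
      ≤ ENNReal.ofReal (Real.exp (-(D - w / cTilde) ^ 2 / (64 * σ ^ 2))) := by
  have h1 := measure_le_of_lintegral_exp_le (Q := Q) (a := 5 * D ^ 2 / 16 / (16 * σ ^ 2))
    (by fun_prop) (lintegral_exp_sq_norm_le hZ hσ hsub)
  have hset : {ω | 5 * D ^ 2 / 16 ≤ ‖Z ω‖ ^ 2}
      = {ω | 5 * D ^ 2 / 16 / (16 * σ ^ 2) ≤ ‖Z ω‖ ^ 2 / (16 * σ ^ 2)} := by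
    ext ω
    simp only [Set.mem_ofPred_eq]
    rw [div_le_div_iff_of_pos_right (by positivity)]
  rw [hset]
  refine h1.trans (ENNReal.ofReal_le_ofReal (Real.exp_le_exp.2 ?_))
  have hct : 0 < cTilde := by unfold cTilde; positivity
  have hct2 : cTilde ^ 2 = 10 / 64 := by
    unfold cTilde
    rw [div_pow, Real.sq_sqrt (by norm_num)]; norm_num
  obtain ⟨u, rfl⟩ : ∃ u, w = cTilde * u := ⟨w / cTilde, by field_simp⟩
  have hu : u ≤ D := le_of_mul_le_mul_left hw hct
  have hu0 : 0 ≤ u := by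
    by_contra hneg
    have := mul_neg_of_pos_of_neg hct (not_le.1 hneg)
    linarith [norm_nonneg δ]
  have hδ2 : ‖δ‖ ^ 2 ≤ 10 / 64 * u ^ 2 := by
    rw [← hct2, ← mul_pow]
    exact pow_le_pow_left₀ (norm_nonneg _) hδ 2
  have hd : 64 * σ ^ 2 * d ≤ D ^ 2 := by
    have := pow_le_pow_left₀ (by positivity) hD 2
    rw [mul_pow, mul_pow, Real.sq_sqrt (Nat.cast_nonneg d)] at this
    linarith
  rw [mul_div_cancel_left₀ _ hct.ne']
  -- The first two terms are at most `D²/6` and `5u²/6`, so the inequality holds with slack `D²/12 +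
  -- u(2D - 11u/6)`, nonnegative for `0 ≤ u ≤ D`.
  have key : 64 * σ ^ 2 * d / 6 + 64 * ‖δ‖ ^ 2 / 12 - 5 * D ^ 2 / 4 ≤ -(D - u) ^ 2 := by
    nlinarith [mul_nonneg hu0 (sub_nonneg.2 hu)]
  have : (d : ℝ) / 6 + ‖δ‖ ^ 2 / (12 * σ ^ 2) - 5 * D ^ 2 / 16 / (16 * σ ^ 2)
      = (64 * σ ^ 2 * d / 6 + 64 * ‖δ‖ ^ 2 / 12 - 5 * D ^ 2 / 4) / (64 * σ ^ 2) := by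
    field_simp
    ring
  rw [this]
  exact div_le_div_of_nonneg_right key (by positivity)

omit [IsProbabilityMeasure Q] in
-- If `‖Z‖ ≤ 3D/4` while `‖δ‖ ≥ D`, then `Z - δ` moves by at least `D/4` in the direction `-δ`; one
-- linear functional detects this, so the bound is free of the dimension.
theorem measure_norm_le_le (hZ : Measurable Z) (hσ : 0 < σ)
    (hsub : ∀ v : Pt d, ∫⁻ ω, ENNReal.ofReal (Real.exp (inner ℝ v (Z ω - δ))) ∂Q
      ≤ ENNReal.ofReal (Real.exp (σ ^ 2 * ‖v‖ ^ 2)))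
    {D : ℝ} (hD : 0 < D) (hδ : D ≤ ‖δ‖) :
    Q {ω | ‖Z ω‖ ≤ 3 / 4 * D} ≤ ENNReal.ofReal (Real.exp (-D ^ 2 / (64 * σ ^ 2))) := by
  have hδ0 : 0 < ‖δ‖ := hD.trans_le hδ
  -- This `t` minimises the Chernoff exponent `σ²t² - tD/4`, with minimum `-D²/(64σ²)`.
  set t : ℝ := D / (8 * σ ^ 2) with ht
  have ht0 : 0 < t := by positivity
  set v : Pt d := (-(t / ‖δ‖)) • δ with hv
  have hvn : ‖v‖ = t := by
    rw [hv, norm_smul, norm_neg, Real.norm_of_nonneg (by positivity)]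
    field_simp
  have hvs := hsub v
  rw [hvn] at hvs
  have h1 := measure_le_of_lintegral_exp_le (Q := Q) (a := t * (D / 4)) (by fun_prop) hvs
  refine (measure_mono fun ω hω => ?_).trans
    (h1.trans (ENNReal.ofReal_le_ofReal (Real.exp_le_exp.2 ?_)))
  · simp only [Set.mem_ofPred_eq] at hω ⊢
    have hvz : -(t * ‖Z ω‖) ≤ inner ℝ v (Z ω) := by
      have := abs_real_inner_le_norm v (Z ω)
      rw [hvn] at this
      exact (abs_le.1 this).1
    have hvd : inner ℝ v δ = -(t * ‖δ‖) := by
      rw [hv, inner_smul_left, real_inner_self_eq_norm_sq]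
      simp only [conj_trivial]
      field_simp
    rw [inner_sub_right, hvd]
    nlinarith
  · apply le_of_eq
    rw [ht]
    field_simp
    ring

end Tails
end RobustClustering

namespace RobustClustering

/-! ### Counting atypical pairs by splitting them into matchings -/

section Matching

variable {Ω : Type*} [MeasurableSpace Ω] {Q : Measure Ω} {E : Type*} [MeasurableSpace E]

/-- Induction on the matching: the inserted pair uses coordinates disjoint from all the others, so
block independence splits off its factor. -/
theorem lintegral_prod_pairs_eq {ι : Type*} [Fintype ι] [DecidableEq ι] {Y : ι → Ω → E}
    (hY : ∀ i, Measurable (Y i)) (hind : iIndepFun Y Q) {F : ι × ι → E × E → ENNReal}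
    (hF : ∀ e, Measurable (F e)) (M : Finset (ι × ι))
    (hM : ∀ e ∈ M, ∀ e' ∈ M, e ≠ e' →
      e.1 ≠ e'.1 ∧ e.1 ≠ e'.2 ∧ e.2 ≠ e'.1 ∧ e.2 ≠ e'.2) :
    ∫⁻ ω, ∏ e ∈ M, F e (Y e.1 ω, Y e.2 ω) ∂Q
      = ∏ e ∈ M, ∫⁻ ω, F e (Y e.1 ω, Y e.2 ω) ∂Q := by
  have := hind.isProbabilityMeasure
  induction M using Finset.induction_on with
  | empty => simp
  | insert a s ha ih =>
    have hs : ∀ e ∈ s, e.1 ∉ ({a.1, a.2} : Finset ι) ∧ e.2 ∉ ({a.1, a.2} : Finset ι) := by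
      intro e he
      have := hM e (Finset.mem_insert_of_mem he) a (Finset.mem_insert_self a s)
        (fun h => ha (h ▸ he))
      simp only [Finset.mem_insert, Finset.mem_singleton, not_or]
      tauto
    simp only [Finset.prod_insert ha]
    rw [← ih fun e he e' he' => hM e (Finset.mem_insert_of_mem he) e'
      (Finset.mem_insert_of_mem he')]
    have hdis : Disjoint ({a.1, a.2} : Finset ι) ({a.1, a.2} : Finset ι)ᶜ := disjoint_compl_right
    have hi := hind.indepFun_finset _ _ hdis hY
    let f : (({a.1, a.2} : Finset ι) → E) → ENNReal := fun x =>
      F a (x ⟨a.1, by simp⟩, x ⟨a.2, by simp⟩)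
    have hf : Measurable f := (hF a).comp (by fun_prop)
    let g : ((({a.1, a.2} : Finset ι)ᶜ : Finset ι) → E) → ENNReal := fun x =>
      ∏ e ∈ s.attach, F e.1 (x ⟨e.1.1, Finset.mem_compl.2 (hs e.1 e.2).1⟩,
        x ⟨e.1.2, Finset.mem_compl.2 (hs e.1 e.2).2⟩)
    have hg : Measurable g :=
      Finset.measurable_prod _ fun e _ => (hF e.1).comp (by fun_prop)
    have h := hi.comp hf hg
    have h2 := lintegral_mul_eq_lintegral_mul_lintegral_of_indepFun
      (hf.comp (by fun_prop)) (hg.comp (by fun_prop)) h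
    have hg' : ∀ ω, g (fun i => Y i ω) = ∏ e ∈ s, F e (Y e.1 ω, Y e.2 ω) := fun ω =>
      Finset.prod_attach s fun e => F e (Y e.1 ω, Y e.2 ω)
    simp only [Pi.mul_apply, Function.comp_def, hg'] at h2
    exact h2

/-- Since `e < 3`, `exp(1_S) ≤ 1 + 2·1_S`; integrate and use `1 + x ≤ exp x`. -/
theorem lintegral_exp_indicator_le [IsProbabilityMeasure Q] {S : Set Ω} (hS : MeasurableSet S)
    {p : ℝ} (hp : 0 ≤ p) (hSp : Q S ≤ ENNReal.ofReal p) :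
    ∫⁻ ω, ENNReal.ofReal (Real.exp (S.indicator 1 ω)) ∂Q ≤ ENNReal.ofReal (Real.exp (2 * p)) := by
  have he : Real.exp 1 ≤ 1 + 2 := by linarith [Real.exp_one_lt_three]
  calc ∫⁻ ω, ENNReal.ofReal (Real.exp (S.indicator 1 ω)) ∂Q
      ≤ ∫⁻ ω, (1 + S.indicator (fun _ => 2) ω) ∂Q := by
        refine lintegral_mono fun ω => ?_
        by_cases h : ω ∈ S
        · simp only [Set.indicator_of_mem h, Pi.one_apply]
          refine (ENNReal.ofReal_le_ofReal he).trans_eq ?_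
          rw [ENNReal.ofReal_add (by norm_num) (by norm_num)]; simp
        · simp [Set.indicator_of_notMem h]
    _ = 1 + 2 * Q S := by
        rw [lintegral_add_left measurable_const, lintegral_indicator_const hS]; simp
    _ ≤ 1 + 2 * ENNReal.ofReal p := by gcongr
    _ = ENNReal.ofReal (1 + 2 * p) := by
        rw [ENNReal.ofReal_add (by norm_num) (by positivity),
          ENNReal.ofReal_mul (by norm_num)]; simp
    _ ≤ ENNReal.ofReal (Real.exp (2 * p)) :=
        ENNReal.ofReal_le_ofReal (by linarith [Real.add_one_le_exp (2 * p)])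

/-- The pairs `i < j` in `Fin n` with `i + j ≡ s` modulo `n`; no two of them meet. -/
def sumMatching (n : ℕ) (s : Fin n) : Finset (Fin n × Fin n) :=
  Finset.univ.filter fun e => e.1 < e.2 ∧ (e.1.val + e.2.val) % n = s.val

/-- Once `i + j` is fixed modulo `n`, one endpoint determines the other; the condition `i < j`
excludes a reversed copy. -/
theorem sumMatching_disjoint {n : ℕ} (s : Fin n) : ∀ e ∈ sumMatching n s,
    ∀ e' ∈ sumMatching n s, e ≠ e' → e.1 ≠ e'.1 ∧ e.1 ≠ e'.2 ∧ e.2 ≠ e'.1 ∧ e.2 ≠ e'.2 := by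
  rintro ⟨⟨a, ha⟩, ⟨b, hb⟩⟩ he ⟨⟨a', ha'⟩, ⟨b', hb'⟩⟩ he' hne
  simp only [sumMatching, Finset.mem_filter, Finset.mem_univ, true_and, Fin.mk_lt_mk] at he he'
  simp only [ne_eq, Prod.mk.injEq, Fin.mk.injEq] at hne ⊢
  obtain ⟨hab, h⟩ := he
  obtain ⟨hab', h'⟩ := he'
  have hmod : a + b ≡ a' + b' [MOD n] := h.trans h'.symm
  have cancel : ∀ x y z : ℕ, y < n → z < n → x + y ≡ x + z [MOD n] → y = z :=
    fun x y z hy hz hh => (Nat.ModEq.add_left_cancel' x hh).eq_of_lt_of_lt hy hz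
  refine ⟨?_, ?_, ?_, ?_⟩
  · rintro rfl
    exact hne ⟨rfl, cancel _ _ _ hb hb' hmod⟩
  · rintro rfl
    have := cancel a b a' hb ha' (by rwa [add_comm a a'])
    omega
  · rintro rfl
    have := cancel b a b' ha hb' (by rwa [add_comm b a])
    omega
  · rintro rfl
    exact hne ⟨cancel b a a' ha ha' (by rwa [add_comm b a, add_comm b a']), rfl⟩

theorem card_sumMatching_le {n : ℕ} (s : Fin n) : (sumMatching n s).card ≤ n := by
  have : Set.InjOn Prod.fst (sumMatching n s : Set (Fin n × Fin n)) := fun e he e' he' h => by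
    by_contra hne
    exact (sumMatching_disjoint s e he e' he' hne).1 h
  calc (sumMatching n s).card = ((sumMatching n s).image Prod.fst).card :=
        (Finset.card_image_of_injOn this).symm
    _ ≤ (Finset.univ : Finset (Fin n)).card := Finset.card_le_univ _
    _ = n := by simp

theorem sum_sumMatching {n : ℕ} (f : Fin n × Fin n → ℝ) :
    ∑ s, ∑ e ∈ sumMatching n s, f e
      = ∑ e ∈ Finset.univ.filter (fun e : Fin n × Fin n => e.1 < e.2), f e := by
  rw [← Finset.sum_fiberwise_of_maps_to (t := Finset.univ)
    (g := fun e : Fin n × Fin n =>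
      (⟨(e.1.val + e.2.val) % n, Nat.mod_lt _ e.1.pos⟩ : Fin n)) (by simp)]
  refine Finset.sum_congr rfl fun s _ => Finset.sum_congr ?_ fun _ _ => rfl
  ext e
  simp [sumMatching, Fin.ext_iff]

/-- Upper tail of the number of ordered pairs of independent points that fall into sets of
probability at most `p`. -/
theorem measure_pair_count_ge_le [IsProbabilityMeasure Q] {n : ℕ} (hn : 0 < n)
    {Y : Fin n → Ω → E} (hY : ∀ i, Measurable (Y i)) (hind : iIndepFun Y Q)
    {A : Fin n × Fin n → Set (E × E)} (hA : ∀ e, MeasurableSet (A e)) {p : ℝ} (hp : 0 ≤ p)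
    (hAp : ∀ e, e.1 < e.2 → Q {ω | (Y e.1 ω, Y e.2 ω) ∈ A e} ≤ ENNReal.ofReal p) (a : ℝ) :
    Q {ω | 2 * n ^ 2 * p + n * a ≤ ∑ e ∈ Finset.univ.filter (fun e : Fin n × Fin n => e.1 < e.2),
        (A e).indicator (1 : E × E → ℝ) (Y e.1 ω, Y e.2 ω)}
      ≤ ENNReal.ofReal (Real.exp (-a)) := by
  have hn' : (0 : ℝ) < n := by exact_mod_cast hn
  set f : Fin n × Fin n → Ω → ℝ := fun e ω =>
    (A e).indicator (1 : E × E → ℝ) (Y e.1 ω, Y e.2 ω) with hfdef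
  have hind1 : ∀ e, Measurable ((A e).indicator (1 : E × E → ℝ)) := fun e =>
    measurable_one.indicator (hA e)
  have hf : ∀ e, Measurable (f e) := fun e => (hind1 e).comp ((hY e.1).prodMk (hY e.2))
  have hmatch : ∀ s, ∫⁻ ω, ENNReal.ofReal (Real.exp (∑ e ∈ sumMatching n s, f e ω)) ∂Q
      ≤ ENNReal.ofReal (Real.exp (2 * n * p)) := by
    intro s
    have h1 : ∀ ω, ENNReal.ofReal (Real.exp (∑ e ∈ sumMatching n s, f e ω))
        = ∏ e ∈ sumMatching n s, (fun x => ENNReal.ofReal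
          (Real.exp ((A e).indicator (1 : E × E → ℝ) x))) (Y e.1 ω, Y e.2 ω) := fun ω => by
      rw [Real.exp_sum, ENNReal.ofReal_prod_of_nonneg fun _ _ => (Real.exp_pos _).le]
    simp only [h1]
    rw [lintegral_prod_pairs_eq hY hind (F := fun e x => ENNReal.ofReal
          (Real.exp ((A e).indicator (1 : E × E → ℝ) x)))
        (fun e => (hind1 e).exp.ennreal_ofReal) _ (sumMatching_disjoint s)]
    have hone : ENNReal.ofReal 1 ≤ ENNReal.ofReal (Real.exp (2 * p)) :=
      ENNReal.ofReal_le_ofReal (Real.one_le_exp (by positivity))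
    calc _ ≤ ∏ e ∈ sumMatching n s, ENNReal.ofReal (Real.exp (2 * p)) := by
          refine Finset.prod_le_prod' fun e he => ?_
          have hlt : e.1 < e.2 := (Finset.mem_filter.1 he).2.1
          exact lintegral_exp_indicator_le
            (S := {ω | (Y e.1 ω, Y e.2 ω) ∈ A e})
            (((hY e.1).prodMk (hY e.2)) (hA e)) hp (hAp e hlt)
      _ ≤ ENNReal.ofReal (Real.exp (2 * p)) ^ n := by
          rw [Finset.prod_const]
          exact pow_le_pow_right₀ (by simpa using hone) (card_sumMatching_le s)
      _ = ENNReal.ofReal (Real.exp (2 * n * p)) := by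
          rw [← ENNReal.ofReal_pow (Real.exp_pos _).le, ← Real.exp_nat_mul]; ring_nf
  -- The total divided by `n` is the average of the `n` matching sums, so convexity removes the
  -- dependence between different matchings.
  have hjensen : ∀ ω, Real.exp ((∑ e ∈ Finset.univ.filter
        (fun e : Fin n × Fin n => e.1 < e.2), f e ω) / n)
      ≤ ∑ s : Fin n, (1 / n : ℝ) * Real.exp (∑ e ∈ sumMatching n s, f e ω) := by
    intro ω
    have h := convexOn_exp.map_sum_le (t := Finset.univ) (w := fun _ : Fin n => (1 / n : ℝ))
      (p := fun s => ∑ e ∈ sumMatching n s, f e ω) (fun _ _ => by positivity)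
      (by simp; field_simp) (fun _ _ => Set.mem_univ _)
    simp only [smul_eq_mul] at h
    rw [← Finset.mul_sum, sum_sumMatching (fun e => f e ω)] at h
    rwa [div_eq_inv_mul, ← one_div]
  have htot : ∫⁻ ω, ENNReal.ofReal (Real.exp ((∑ e ∈ Finset.univ.filter
        (fun e : Fin n × Fin n => e.1 < e.2), f e ω) / n)) ∂Q
      ≤ ENNReal.ofReal (Real.exp (2 * n * p)) := by
    calc _ ≤ ∫⁻ ω, ∑ s : Fin n, ENNReal.ofReal (1 / n)
            * ENNReal.ofReal (Real.exp (∑ e ∈ sumMatching n s, f e ω)) ∂Q := by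
          refine lintegral_mono fun ω => (ENNReal.ofReal_le_ofReal (hjensen ω)).trans_eq ?_
          rw [ENNReal.ofReal_sum_of_nonneg fun _ _ => by positivity]
          exact Finset.sum_congr rfl fun s _ => ENNReal.ofReal_mul (by positivity)
      _ = ∑ s : Fin n, ENNReal.ofReal (1 / n)
            * ∫⁻ ω, ENNReal.ofReal (Real.exp (∑ e ∈ sumMatching n s, f e ω)) ∂Q := by
          have hm : ∀ s, Measurable fun ω =>
              ENNReal.ofReal (Real.exp (∑ e ∈ sumMatching n s, f e ω)) := fun s =>
            (Finset.measurable_fun_sum _ fun e _ => hf e).exp.ennreal_ofReal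
          rw [lintegral_finsetSum _ fun s _ => (hm s).const_mul _]
          exact Finset.sum_congr rfl fun s _ => lintegral_const_mul _ (hm s)
      _ ≤ ∑ s : Fin n, ENNReal.ofReal (1 / n) * ENNReal.ofReal (Real.exp (2 * n * p)) :=
          Finset.sum_le_sum fun s _ => by gcongr; exact hmatch s
      _ = ENNReal.ofReal (Real.exp (2 * n * p)) := by
          rw [← Finset.sum_mul, ← ENNReal.ofReal_sum_of_nonneg fun _ _ => by positivity]
          have : ∑ _s : Fin n, (1 / n : ℝ) = 1 := by simp; field_simp
          rw [this]; simp
  have hfin := measure_le_of_lintegral_exp_le (Q := Q) (a := 2 * n * p + a)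
    ((Finset.measurable_fun_sum _ fun e _ => hf e).div_const (n : ℝ)) htot
  refine (measure_mono fun ω hω => ?_).trans (hfin.trans_eq (by ring_nf))
  simp only [Set.mem_ofPred_eq] at hω ⊢
  rw [le_div_iff₀ hn']
  refine le_trans (le_of_eq ?_) hω
  ring

end Matching

/-! ### Sub-gaussian differences -/

section Difference

variable {d : ℕ} {Ω : Type*} [MeasurableSpace Ω] {Q : Measure Ω}

/-- Exponents `σ²‖v‖²/2` add under independence, which explains the missing factor `1/2` in the
hypothesis of the tail bounds. -/
theorem lintegral_exp_inner_sub_le {Y₁ Y₂ : Ω → Pt d} (h₁ : Measurable Y₁) (h₂ : Measurable Y₂)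
    (hind : IndepFun Y₁ Y₂ Q) {μ₁ μ₂ : Pt d} {σ : ℝ}
    (hs₁ : ∀ v : Pt d, ∫⁻ ω, ENNReal.ofReal (Real.exp (inner ℝ v (Y₁ ω - μ₁))) ∂Q
      ≤ ENNReal.ofReal (Real.exp (σ ^ 2 * ‖v‖ ^ 2 / 2)))
    (hs₂ : ∀ v : Pt d, ∫⁻ ω, ENNReal.ofReal (Real.exp (inner ℝ v (Y₂ ω - μ₂))) ∂Q
      ≤ ENNReal.ofReal (Real.exp (σ ^ 2 * ‖v‖ ^ 2 / 2))) (v : Pt d) :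
    ∫⁻ ω, ENNReal.ofReal (Real.exp (inner ℝ v ((Y₁ ω - Y₂ ω) - (μ₁ - μ₂)))) ∂Q
      ≤ ENNReal.ofReal (Real.exp (σ ^ 2 * ‖v‖ ^ 2)) := by
  let f : Pt d → ENNReal := fun x => ENNReal.ofReal (Real.exp (inner ℝ v (x - μ₁)))
  let g : Pt d → ENNReal := fun x => ENNReal.ofReal (Real.exp (inner ℝ (-v) (x - μ₂)))
  have hf : Measurable f := by fun_prop
  have hg : Measurable g := by fun_prop
  have h := lintegral_mul_eq_lintegral_mul_lintegral_of_indepFun (hf.comp h₁) (hg.comp h₂)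
    (hind.comp hf hg)
  have e : ∀ ω, ENNReal.ofReal (Real.exp (inner ℝ v ((Y₁ ω - Y₂ ω) - (μ₁ - μ₂))))
      = ((f ∘ Y₁) * (g ∘ Y₂)) ω := fun ω => by
    simp only [Pi.mul_apply, Function.comp_apply, f, g]
    rw [← ENNReal.ofReal_mul (Real.exp_pos _).le, ← Real.exp_add, inner_neg_left,
      ← sub_eq_add_neg, ← inner_sub_right, sub_sub_sub_comm]
  simp only [e]
  rw [h]
  refine (mul_le_mul' (hs₁ v) (hs₂ (-v))).trans_eq ?_
  rw [← ENNReal.ofReal_mul (Real.exp_pos _).le, ← Real.exp_add, norm_neg]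
  ring_nf

end Difference
end RobustClustering

namespace RobustClustering

/-! ### Entrywise solution of the linear program -/

section LinearProgram

/-- Compare `X` with its entrywise thresholding `X'`, which keeps `X` at ties. No term of the
objective decreases, so optimality forces equality in every term. -/
theorem IsRobustLPSolution.eq_of_ne {ι : Type*} [Fintype ι] {K X : Matrix ι ι ℝ} {γ : ℝ}
    (h : IsRobustLPSolution K γ X) (i j : ι) :
    (γ < K i j → X i j = 1) ∧ (K i j < γ → X i j = 0) := by
  classical
  obtain ⟨hX, hopt⟩ := h
  set X' : Matrix ι ι ℝ := fun i j => if γ < K i j then 1 else if K i j < γ then 0 else X i j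
    with hX'
  have hle : ∀ a b, (K a b - γ) * X a b ≤ (K a b - γ) * X' a b := by
    intro a b
    have hab := hX a b
    simp only [hX']
    split_ifs <;> nlinarith
  have hfeas : ∀ a b, 0 ≤ X' a b ∧ X' a b ≤ 1 := by
    intro a b
    simp only [hX']
    split_ifs <;> simp [hX a b]
  have hrow : ∀ a, ∑ b, (K a b - γ) * X a b ≤ ∑ b, (K a b - γ) * X' a b := fun a =>
    Finset.sum_le_sum fun b _ => hle a b
  have h1 := (Finset.sum_eq_sum_iff_of_le fun a _ => hrow a).1
    (le_antisymm (Finset.sum_le_sum fun a _ => hrow a) (hopt X' hfeas)) i (Finset.mem_univ i)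
  have h2 := (Finset.sum_eq_sum_iff_of_le fun b _ => hle i b).1 h1 j (Finset.mem_univ j)
  simp only [hX'] at h2
  constructor
  · intro hlt
    rw [if_pos hlt] at h2
    exact mul_left_cancel₀ (sub_pos.2 hlt).ne' h2
  · intro hlt
    rw [if_neg hlt.not_gt, if_pos hlt] at h2
    exact mul_left_cancel₀ (sub_neg.2 hlt).ne h2

theorem lt_kernelMatrix {ι : Type*} {d : ℕ} {θ γ D : ℝ} (hθ : 0 < θ)
    (hγ : γ < Real.exp (-5 * D ^ 2 / (32 * θ ^ 2))) {y : ι → Pt d} {i j : ι}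
    (h : ‖y i - y j‖ ^ 2 < 5 * D ^ 2 / 16) : γ < kernelMatrix θ y i j := by
  refine hγ.trans (Real.exp_lt_exp.2 ?_)
  rw [div_lt_div_iff₀ (by positivity) (by positivity)]
  have : 0 < θ ^ 2 := by positivity
  nlinarith

/-- The kernel reaches the lower end of the window at distance `D/√2`, and `3/4 > 1/√2`. -/
theorem kernelMatrix_lt {ι : Type*} {d : ℕ} {θ γ D : ℝ} (hθ : 0 < θ) (hD : 0 < D)
    (hγ : Real.exp (-D ^ 2 / (4 * θ ^ 2)) < γ) {y : ι → Pt d} {i j : ι}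
    (h : 3 / 4 * D < ‖y i - y j‖) : kernelMatrix θ y i j < γ := by
  refine (Real.exp_lt_exp.2 ?_).trans hγ
  rw [div_lt_div_iff₀ (by positivity) (by positivity)]
  have : 0 < θ ^ 2 := by positivity
  have h2 : (3 / 4 * D) ^ 2 < ‖y i - y j‖ ^ 2 := pow_lt_pow_left₀ h (by positivity) two_ne_zero
  have h3 : D ^ 2 < 2 * ‖y i - y j‖ ^ 2 := by nlinarith [sq_nonneg D]
  nlinarith

end LinearProgram

/-! ### Cluster sizes and entrywise norms -/

theorem clusterSize_le {n r : ℕ} (c : Fin n → Fin r) (k : Fin r) : clusterSize c k ≤ n :=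
  (Finset.card_le_univ _).trans_eq (by simp)

theorem minClusterSize_le {n r : ℕ} (c : Fin n → Fin r) (k : Fin r) : minClusterSize c ≤ n :=
  (ciInf_le (OrderBot.bddBelow _) k).trans (clusterSize_le c k)

/-- Cauchy–Schwarz for the `r` cluster sizes, whose sum is `n` and whose squares sum to the number
of same-label pairs. -/
theorem sq_le_mul_sum_ite_eq {n r : ℕ} (c : Fin n → Fin r) :
    (n : ℝ) ^ 2 ≤ r * ∑ i, ∑ j, if c i = c j then (1 : ℝ) else 0 := by
  have h1 : ∑ k : Fin r, ∑ i, (if c i = k then (1 : ℝ) else 0) = n := by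
    rw [Finset.sum_comm]; simp
  have h2 : ∑ k : Fin r, (∑ i, (if c i = k then (1 : ℝ) else 0)) ^ 2
      = ∑ i, ∑ j, if c i = c j then (1 : ℝ) else 0 := by
    simp only [sq, Finset.sum_mul_sum]
    rw [Finset.sum_comm]
    refine Finset.sum_congr rfl fun i _ => ?_
    rw [Finset.sum_comm]
    refine Finset.sum_congr rfl fun j _ => ?_
    simp [eq_comm]
  have h := sq_sum_le_card_mul_sum_sq (s := Finset.univ)
    (f := fun k : Fin r => ∑ i, (if c i = k then (1 : ℝ) else 0))
  rw [h1, h2] at h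
  simpa using h

theorem l1Norm_le_inlierPart_add {n m : ℕ} {X Y : Matrix (Fin n ⊕ Fin m) (Fin n ⊕ Fin m) ℝ}
    (h : ∀ a b, |X a b - Y a b| ≤ 1) :
    l1Norm (X - Y) ≤ l1Norm (inlierPart X - inlierPart Y) + (2 * n * m + m * m) := by
  have bound : ∀ {α β : Type} [Fintype α] [Fintype β] (f : α → β → ℝ), (∀ a b, f a b ≤ 1) →
      ∑ a, ∑ b, f a b ≤ Fintype.card α * Fintype.card β := by
    intro α β _ _ f hf
    calc ∑ a, ∑ b, f a b ≤ ∑ _a : α, ∑ _b : β, (1 : ℝ) :=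
          Finset.sum_le_sum fun a _ => Finset.sum_le_sum fun b _ => hf a b
      _ = _ := by simp
  have h1 := bound (fun (i : Fin n) (j : Fin m) => |X (.inl i) (.inr j) - Y (.inl i) (.inr j)|)
    fun _ _ => h _ _
  have h2 := bound (fun (i : Fin m) (j : Fin n) => |X (.inr i) (.inl j) - Y (.inr i) (.inl j)|)
    fun _ _ => h _ _
  have h3 := bound (fun (i : Fin m) (j : Fin m) => |X (.inr i) (.inr j) - Y (.inr i) (.inr j)|)
    fun _ _ => h _ _
  simp only [Fintype.card_fin] at h1 h2 h3
  simp only [l1Norm, Fintype.sum_sum_type, Finset.sum_add_distrib, inlierPart, Matrix.sub_apply,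
    Matrix.submatrix_apply]
  linarith

/-! ### Separations in the mixture and conditioning on the labels -/

namespace SubGaussianMixture

variable {d r : ℕ} (M : SubGaussianMixture d r)

theorem param_le_sigmaMax (k : Fin r) : M.param k ≤ M.sigmaMax :=
  le_ciSup (Set.finite_range M.param).bddAbove k

theorem sigmaMax_pos (k : Fin r) : 0 < M.sigmaMax :=
  (M.subGaussian k).param_pos.trans_le (M.param_le_sigmaMax k)

theorem sep_comm (k l : Fin r) : M.sep k l = M.sep l k := norm_sub_rev _ _

theorem weak_comm {k l : Fin r} : M.Weak k l ↔ M.Weak l k := by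
  rw [Weak, Weak, sep_comm]

theorem maxWeakSep_nonneg : 0 ≤ M.maxWeakSep := by
  -- The set may be empty; its supremum is then 0 by convention.
  refine Real.sSup_nonneg ?_
  rintro _ ⟨k, l, -, -, rfl⟩
  exact norm_nonneg _

theorem sep_le_maxWeakSep {k l : Fin r} (h : k = l ∨ M.Weak k l) : M.sep k l ≤ M.maxWeakSep := by
  by_cases hkl : k = l
  · subst hkl
    simpa [sep] using M.maxWeakSep_nonneg
  · refine le_csSup ⟨M.sepThreshold, ?_⟩ ⟨k, l, hkl, h.resolve_left hkl, rfl⟩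
    rintro _ ⟨_, _, -, h, rfl⟩
    exact h.le

theorem minWellSep_le_sep {k l : Fin r} (hkl : k ≠ l) (h : ¬ M.Weak k l) :
    M.minWellSep ≤ M.sep k l := by
  refine csInf_le ⟨0, ?_⟩ ⟨k, l, hkl, not_lt.1 h, rfl⟩
  rintro _ ⟨_, _, -, -, rfl⟩
  exact norm_nonneg _

theorem sepThreshold_le_minWellSep (h : ∃ k l, k ≠ l ∧ M.sepThreshold ≤ M.sep k l) :
    M.sepThreshold ≤ M.minWellSep := by
  obtain ⟨k, l, hkl, h⟩ := h
  refine le_csInf ⟨_, k, l, hkl, h, rfl⟩ ?_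
  rintro _ ⟨_, _, -, h, rfl⟩
  exact h

theorem lintegral_exp_law_le (k : Fin r) (v : Pt d) :
    ∫⁻ x, ENNReal.ofReal (Real.exp (inner ℝ v (x - M.center k))) ∂(M.law k)
      ≤ ENNReal.ofReal (Real.exp (M.sigmaMax ^ 2 * ‖v‖ ^ 2 / 2)) := by
  have h := M.subGaussian k
  rw [← ofReal_integral_eq_lintegral_ofReal (h.integrable_exp v)
    (ae_of_all _ fun _ => (Real.exp_pos _).le)]
  refine ENNReal.ofReal_le_ofReal ((h.mgf_le v).trans (Real.exp_le_exp.2 ?_))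
  have := pow_le_pow_left₀ h.param_pos.le (M.param_le_sigmaMax k) 2
  gcongr

theorem labelledLaw_singleton_prod (k : Fin r) (A : Set (Pt d)) :
    M.labelledLaw ({k} ×ˢ A) = ENNReal.ofReal (M.weight k) * M.law k A := by
  have := fun k => (M.subGaussian k).isProbabilityMeasure
  rw [labelledLaw, Measure.finsetSum_apply, Finset.sum_eq_single k]
  · rw [Measure.smul_apply, Measure.prod_prod]; simp
  · intro l _ hl
    rw [Measure.smul_apply, Measure.prod_prod]; simp [hl]
  · simp

section Conditional

variable {M} {Ω : Type*} [MeasurableSpace Ω] {P : Measure Ω} {n : ℕ}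
  {φ : Fin n → Ω → Fin r} {y : Fin n → Ω → Pt d}

theorem IsSample.measure_inter (h : M.IsSample P φ y) (i : Fin n) (k : Fin r) {A : Set (Pt d)}
    (hA : MeasurableSet A) :
    P (φ i ⁻¹' {k} ∩ y i ⁻¹' A) = ENNReal.ofReal (M.weight k) * M.law k A := by
  rw [← labelledLaw_singleton_prod, ← h.law_eq i,
    Measure.map_apply ((h.measurable_label i).prodMk (h.measurable_point i))
      ((measurableSet_singleton k).prod hA)]
  rfl

omit [MeasurableSpace Ω] in
theorem setOf_labels_eq (c : Fin n → Fin r) :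
    {ω | ∀ i, φ i ω = c i} = ⋂ i, φ i ⁻¹' {c i} := by
  ext ω; simp

theorem IsSample.indep_swap (h : M.IsSample P φ y) :
    iIndepFun (fun i ω => (y i ω, φ i ω)) P :=
  h.indep.comp (fun _ x => (x.2, x.1)) fun _ => measurable_snd.prodMk measurable_fst

theorem measure_label_ne_zero {c : Fin n → Fin r} (hc : P {ω | ∀ i, φ i ω = c i} ≠ 0)
    (i : Fin n) : P (φ i ⁻¹' {c i}) ≠ 0 := fun h0 =>
  hc (measure_mono_null (fun _ hω => hω i) h0)

/-- The label event is an intersection of events each involving a single inlier, so conditioning on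
it preserves independence. -/
theorem IsSample.iIndepFun_cond (h : M.IsSample P φ y) {c : Fin n → Fin r}
    (hc : P {ω | ∀ i, φ i ω = c i} ≠ 0) :
    iIndepFun y (cond P {ω | ∀ i, φ i ω = c i}) := by
  rw [setOf_labels_eq]
  exact iIndepFun.cond h.measurable_label h.indep_swap (measure_label_ne_zero hc)
    fun i => measurableSet_singleton _

/-- By independence only the label of `i` itself matters, and its weight cancels in the conditional
probability. -/
theorem IsSample.map_cond (h : M.IsSample P φ y) {c : Fin n → Fin r}
    (hc : P {ω | ∀ i, φ i ω = c i} ≠ 0) (i : Fin n) :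
    (cond P {ω | ∀ i, φ i ω = c i}).map (y i) = M.law (c i) := by
  have := (M.subGaussian (c i)).isProbabilityMeasure
  have hne := measure_label_ne_zero hc i
  ext A hA
  rw [Measure.map_apply (h.measurable_point i) hA, setOf_labels_eq]
  have key := cond_iInter (s := {i}) (f := fun i => y i ⁻¹' A) (t := fun i => {c i})
    h.measurable_label h.indep_swap (fun i _ => ⟨A, hA, rfl⟩)
    (fun i _ => measure_label_ne_zero hc i) fun i => measurableSet_singleton _
  simp only [Finset.mem_singleton, Set.iInter_iInter_eq_left, Finset.prod_singleton] at key
  rw [key, cond_apply (h.measurable_label i (measurableSet_singleton _)), h.measure_inter i _ hA]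
  have hw : P (φ i ⁻¹' {c i}) = ENNReal.ofReal (M.weight (c i)) := by
    have := h.measure_inter i (c i) MeasurableSet.univ
    simpa using this
  rw [hw] at hne ⊢
  rw [← mul_assoc, ENNReal.inv_mul_cancel hne ENNReal.ofReal_ne_top, one_mul]

theorem IsSample.lintegral_exp_cond_le (h : M.IsSample P φ y) {c : Fin n → Fin r}
    (hc : P {ω | ∀ i, φ i ω = c i} ≠ 0) (i : Fin n) (v : Pt d) :
    ∫⁻ ω, ENNReal.ofReal (Real.exp (inner ℝ v (y i ω - M.center (c i))))
        ∂(cond P {ω | ∀ i, φ i ω = c i})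
      ≤ ENNReal.ofReal (Real.exp (M.sigmaMax ^ 2 * ‖v‖ ^ 2 / 2)) := by
  refine le_trans (le_of_eq ?_) (M.lintegral_exp_law_le (c i) v)
  rw [← h.map_cond hc i, lintegral_map (by fun_prop) (h.measurable_point i)]

end Conditional

/-! ### Atypical pairs and their probability -/

/-- The pairs of observations with labels `k` and `l` whose distance is atypical: too large if the
clusters are merged, too small if they are not. -/
def atypicalPairs (k l : Fin r) : Set (Pt d × Pt d) :=
  {x | ((k = l ∨ M.Weak k l) ∧ 5 * M.minWellSep ^ 2 / 16 ≤ ‖x.1 - x.2‖ ^ 2) ∨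
    (¬(k = l ∨ M.Weak k l) ∧ ‖x.1 - x.2‖ ≤ 3 / 4 * M.minWellSep)}

theorem atypicalPairs_of_merged {k l : Fin r} (h : k = l ∨ M.Weak k l) :
    M.atypicalPairs k l = {x | 5 * M.minWellSep ^ 2 / 16 ≤ ‖x.1 - x.2‖ ^ 2} := by
  simp [atypicalPairs, h]

theorem atypicalPairs_of_not_merged {k l : Fin r} (h : ¬(k = l ∨ M.Weak k l)) :
    M.atypicalPairs k l = {x | ‖x.1 - x.2‖ ≤ 3 / 4 * M.minWellSep} := by
  simp [atypicalPairs, h]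

theorem measurableSet_atypicalPairs (k l : Fin r) : MeasurableSet (M.atypicalPairs k l) := by
  by_cases h : k = l ∨ M.Weak k l
  · rw [atypicalPairs_of_merged M h]
    exact measurableSet_le measurable_const (by fun_prop)
  · rw [atypicalPairs_of_not_merged M h]
    exact measurableSet_le (by fun_prop) measurable_const

theorem swap_mem_atypicalPairs {k l : Fin r} {x : Pt d × Pt d} :
    x.swap ∈ M.atypicalPairs l k ↔ x ∈ M.atypicalPairs k l := by
  simp only [atypicalPairs, Set.mem_ofPred_eq, Prod.fst_swap, Prod.snd_swap, M.weak_comm (k := l),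
    eq_comm (a := l), norm_sub_rev x.2]

theorem minWellSep_pos (h : M.maxWeakSep < cTilde * M.minWellSep) : 0 < M.minWellSep := by
  have hct : 0 < cTilde := by unfold cTilde; positivity
  exact pos_of_mul_pos_right (M.maxWeakSep_nonneg.trans_lt h) hct.le

/-- Here `0 ≤ Δ'/c̃ < Δ̃`, so subtracting it only weakens the exponent; one rate then serves both
kinds of pairs. -/
theorem exp_neg_sq_le_errorRate (h : M.maxWeakSep < cTilde * M.minWellSep) :
    Real.exp (-M.minWellSep ^ 2 / (64 * M.sigmaMax ^ 2)) ≤ M.errorRate := by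
  have hct : 0 < cTilde := by unfold cTilde; positivity
  refine Real.exp_le_exp.2 (div_le_div_of_nonneg_right ?_ (by positivity))
  have h1 : M.maxWeakSep / cTilde < M.minWellSep := by
    rwa [div_lt_iff₀ hct, mul_comm]
  have h2 : 0 ≤ M.maxWeakSep / cTilde := div_nonneg M.maxWeakSep_nonneg hct.le
  nlinarith

theorem IsSample.measure_atypical_le {M : SubGaussianMixture d r} {Ω : Type*} [MeasurableSpace Ω]
    {P : Measure Ω} [IsProbabilityMeasure P] {n : ℕ} {φ : Fin n → Ω → Fin r}
    {y : Fin n → Ω → Pt d} (h : M.IsSample P φ y) {c : Fin n → Fin r}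
    (hc : P {ω | ∀ i, φ i ω = c i} ≠ 0)
    (hwell : ∃ k l, k ≠ l ∧ M.sepThreshold ≤ M.sep k l)
    (hw : M.maxWeakSep < cTilde * M.minWellSep) {i j : Fin n} (hij : i ≠ j) :
    cond P {ω | ∀ i, φ i ω = c i} {ω | (y i ω, y j ω) ∈ M.atypicalPairs (c i) (c j)}
      ≤ ENNReal.ofReal M.errorRate := by
  have := cond_isProbabilityMeasure hc
  have hσ := M.sigmaMax_pos (c i)
  have hZ : Measurable fun ω => y i ω - y j ω :=
    (h.measurable_point i).sub (h.measurable_point j)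
  have hsub := lintegral_exp_inner_sub_le (h.measurable_point i) (h.measurable_point j)
    ((h.iIndepFun_cond hc).indepFun hij) (h.lintegral_exp_cond_le hc i)
    (h.lintegral_exp_cond_le hc j)
  by_cases hm : c i = c j ∨ M.Weak (c i) (c j)
  · rw [atypicalPairs_of_merged M hm]
    exact measure_sq_norm_ge_le hZ hσ hsub (M.sepThreshold_le_minWellSep hwell)
      (M.sep_le_maxWeakSep hm) hw.le
  · rw [atypicalPairs_of_not_merged M hm]
    refine (measure_norm_le_le hZ hσ hsub (M.minWellSep_pos hw) ?_).trans
      (ENNReal.ofReal_le_ofReal (M.exp_neg_sq_le_errorRate hw))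
    rw [not_or] at hm
    exact M.minWellSep_le_sep hm.1 hm.2

theorem abs_mergedMatrix_sub_le_one {n m : ℕ} (c : Fin n → Fin r)
    {X : Matrix (Fin n ⊕ Fin m) (Fin n ⊕ Fin m) ℝ} (hX : ∀ i j, 0 ≤ X i j ∧ X i j ≤ 1)
    (a b : Fin n ⊕ Fin m) : |X a b - M.mergedMatrix m c a b| ≤ 1 := by
  have h : 0 ≤ M.mergedMatrix m c a b ∧ M.mergedMatrix m c a b ≤ 1 := by
    rcases a with i | i <;> rcases b with j | j <;> simp only [mergedMatrix]
    · split_ifs <;> norm_num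
    all_goals norm_num
  rw [abs_le]
  constructor <;> linarith [hX a b, h]

theorem sq_le_mul_l1Norm_mergedMatrix {n : ℕ} (m : ℕ) (c : Fin n → Fin r) :
    (n : ℝ) ^ 2 ≤ r * l1Norm (M.mergedMatrix m c) := by
  refine (sq_le_mul_sum_ite_eq c).trans (mul_le_mul_of_nonneg_left ?_ (Nat.cast_nonneg r))
  have h : ∀ i j : Fin n, (if c i = c j then (1 : ℝ) else 0)
      ≤ |M.mergedMatrix m c (.inl i) (.inl j)| := by
    intro i j
    by_cases hc : c i = c j
    · simp [mergedMatrix, hc]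
    · simp [hc]
  simp only [l1Norm, Fintype.sum_sum_type]
  have h0 : ∀ {α β : Type} [Fintype α] [Fintype β] (f : α → β → ℝ),
      0 ≤ ∑ a, ∑ b, |f a b| := fun f =>
    Finset.sum_nonneg fun _ _ => Finset.sum_nonneg fun _ _ => abs_nonneg _
  have h1 := Finset.sum_le_sum fun (i : Fin n) (_ : i ∈ Finset.univ) =>
    Finset.sum_le_sum fun (j : Fin n) (_ : j ∈ Finset.univ) => h i j
  rw [Finset.sum_add_distrib, Finset.sum_add_distrib]
  have := h0 fun (i : Fin n) (j : Fin m) => M.mergedMatrix m c (.inl i) (.inr j)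
  have := h0 fun (i : Fin m) (j : Fin n) => M.mergedMatrix m c (.inr i) (.inl j)
  have := h0 fun (i : Fin m) (j : Fin m) => M.mergedMatrix m c (.inr i) (.inr j)
  linarith

/-! ### From atypical pairs to matrix errors -/

section Deterministic

variable {M} {n m : ℕ} {c : Fin n → Fin r} {θ γ : ℝ} {u : Fin n → Pt d} {z : Fin m → Pt d}
  {X : Matrix (Fin n ⊕ Fin m) (Fin n ⊕ Fin m) ℝ}

theorem solution_eq_mergedMatrix (hD : 0 < M.minWellSep) (hθ : 0 < θ)
    (hγ₁ : Real.exp (-M.minWellSep ^ 2 / (4 * θ ^ 2)) < γ)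
    (hγ₂ : γ < Real.exp (-5 * M.minWellSep ^ 2 / (32 * θ ^ 2)))
    (hX : IsRobustLPSolution (kernelMatrix θ (Sum.elim u z)) γ X) {i j : Fin n}
    (h : (u i, u j) ∉ M.atypicalPairs (c i) (c j)) :
    X (.inl i) (.inl j) = M.mergedMatrix m c (.inl i) (.inl j) := by
  have hs := hX.eq_of_ne (.inl i) (.inl j)
  by_cases hm : c i = c j ∨ M.Weak (c i) (c j)
  · rw [atypicalPairs_of_merged M hm, Set.mem_ofPred_eq, not_le] at h
    rw [hs.1 (lt_kernelMatrix hθ hγ₂ (by simpa using h))]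
    simp [mergedMatrix, hm]
  · rw [atypicalPairs_of_not_merged M hm, Set.mem_ofPred_eq, not_le] at h
    rw [hs.2 (kernelMatrix_lt hθ hD hγ₁ (by simpa using h))]
    simp [mergedMatrix, hm]

theorem l1Norm_inlierPart_sub_le (hD : 0 < M.minWellSep) (hθ : 0 < θ)
    (hγ₁ : Real.exp (-M.minWellSep ^ 2 / (4 * θ ^ 2)) < γ)
    (hγ₂ : γ < Real.exp (-5 * M.minWellSep ^ 2 / (32 * θ ^ 2)))
    (hX : IsRobustLPSolution (kernelMatrix θ (Sum.elim u z)) γ X) :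
    l1Norm (inlierPart X - inlierPart (M.mergedMatrix m c))
      ≤ 2 * ∑ e ∈ Finset.univ.filter (fun e : Fin n × Fin n => e.1 < e.2),
        (M.atypicalPairs (c e.1) (c e.2)).indicator (1 : Pt d × Pt d → ℝ) (u e.1, u e.2) := by
  set g : Fin n → Fin n → ℝ := fun i j =>
    (M.atypicalPairs (c i) (c j)).indicator (1 : Pt d × Pt d → ℝ) (u i, u j) with hg
  have hg0 : ∀ i j, 0 ≤ g i j := fun i j => Set.indicator_nonneg (fun _ _ => zero_le_one) _
  have hsymm : ∀ i j, g i j = g j i := fun i j => by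
    have h := M.swap_mem_atypicalPairs (k := c i) (l := c j) (x := (u i, u j))
    simp only [Prod.swap_prod_mk] at h
    by_cases hm : (u i, u j) ∈ M.atypicalPairs (c i) (c j)
    · simp only [hg, Set.indicator_of_mem hm, Set.indicator_of_mem (h.2 hm), Pi.one_apply]
    · simp only [hg, Set.indicator_of_notMem hm, Set.indicator_of_notMem (mt h.1 hm)]
  have hentry : ∀ i j, |X (.inl i) (.inl j) - M.mergedMatrix m c (.inl i) (.inl j)| ≤ g i j := by
    intro i j
    by_cases hm : (u i, u j) ∈ M.atypicalPairs (c i) (c j)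
    · simpa only [hg, Set.indicator_of_mem hm, Pi.one_apply]
        using M.abs_mergedMatrix_sub_le_one c hX.1 _ _
    · rw [solution_eq_mergedMatrix hD hθ hγ₁ hγ₂ hX hm, sub_self, abs_zero]
      exact hg0 i j
  -- A point is at distance 0 from itself, hence typical; by symmetry, twice the pairs `i < j` then
  -- account for every error.
  have hdiag : ∀ i, X (.inl i) (.inl i) - M.mergedMatrix m c (.inl i) (.inl i) = 0 := by
    intro i
    refine sub_eq_zero.2 (solution_eq_mergedMatrix hD hθ hγ₁ hγ₂ hX ?_)
    rw [atypicalPairs_of_merged M (Or.inl rfl), Set.mem_ofPred_eq]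
    simp only [sub_self, norm_zero]
    have : 0 < M.minWellSep ^ 2 := by positivity
    linarith
  have hsum : ∑ e ∈ Finset.univ.filter (fun e : Fin n × Fin n => e.1 < e.2), g e.1 e.2
      = ∑ i, ∑ j, if i < j then g i j else 0 := by
    rw [Finset.sum_filter, Fintype.sum_prod_type]
  change _ ≤ 2 * ∑ e ∈ Finset.univ.filter (fun e : Fin n × Fin n => e.1 < e.2), g e.1 e.2
  calc l1Norm (inlierPart X - inlierPart (M.mergedMatrix m c))
      ≤ ∑ i, ∑ j, ((if i < j then g i j else 0) + if j < i then g j i else 0) := by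
        refine Finset.sum_le_sum fun i _ => Finset.sum_le_sum fun j _ => ?_
        simp only [inlierPart, Matrix.sub_apply, Matrix.submatrix_apply]
        rcases lt_trichotomy i j with h | rfl | h
        · simpa [h, h.not_gt] using hentry i j
        · simp [hdiag]
        · simpa [h, h.not_gt, hsymm j i] using hentry i j
    _ = 2 * ∑ i, ∑ j, (if i < j then g i j else 0) := by
        simp only [Finset.sum_add_distrib]
        rw [Finset.sum_comm (f := fun i j => if j < i then g j i else 0)]
        ring
    _ = _ := by rw [hsum]

theorem l1Norm_sub_div_le {a b : ℝ} (hn : 0 < n) (hmn : m < n)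
    (hX : ∀ i j, 0 ≤ X i j ∧ X i j ≤ 1) (hb : 0 ≤ b) (ha : 0 ≤ a)
    (h : l1Norm (inlierPart X - inlierPart (M.mergedMatrix m c)) ≤ 6 * n ^ 2 * max a b) :
    l1Norm (X - M.mergedMatrix m c) / l1Norm (M.mergedMatrix m c)
      ≤ 6 * r * a + 9 * r * max b ((m : ℝ) / n) := by
  have hn' : (0 : ℝ) < n := by exact_mod_cast hn
  have hmn' : (m : ℝ) ≤ n := by exact_mod_cast hmn.le
  have hm0 : (0 : ℝ) ≤ m := Nat.cast_nonneg m
  have h1 := l1Norm_le_inlierPart_add (M.abs_mergedMatrix_sub_le_one c hX)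
  have h2 := M.sq_le_mul_l1Norm_mergedMatrix m c
  set L := l1Norm (M.mergedMatrix m c)
  have hr : (0 : ℝ) ≤ r := Nat.cast_nonneg r
  have hL : 0 < L := pos_of_mul_pos_right ((by positivity : (0 : ℝ) < (n : ℝ) ^ 2).trans_le h2) hr
  have hmax : max a b ≤ a + b := max_le (by linarith) (by linarith)
  set q := max b ((m : ℝ) / n)
  have hbq : b ≤ q := le_max_left _ _
  have hmq : (m : ℝ) / n ≤ q := le_max_right _ _
  have hmq' : (n : ℝ) * m ≤ n ^ 2 * q := by
    rw [div_le_iff₀ hn'] at hmq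
    nlinarith
  -- The inliers contribute `6n²(a + q)`, and the outlier blocks `2nm + m² ≤ 3nm ≤ 3n²q`.
  have h3 : l1Norm (X - M.mergedMatrix m c) ≤ n ^ 2 * (6 * a + 9 * q) := by
    have : 6 * (n : ℝ) ^ 2 * max a b ≤ 6 * n ^ 2 * (a + q) :=
      mul_le_mul_of_nonneg_left (by linarith) (by positivity)
    nlinarith
  rw [div_le_iff₀ hL]
  calc _ ≤ (n : ℝ) ^ 2 * (6 * a + 9 * q) := h3
    _ ≤ r * L * (6 * a + 9 * q) := mul_le_mul_of_nonneg_right h2 (by linarith)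
    _ = _ := by ring

end Deterministic

end SubGaussianMixture
end RobustClustering

/-! ### The main theorem -/

theorem mainTheorem5 :
    ∃ C C' C'' : ℝ, 0 < C ∧ 0 < C' ∧ 0 < C'' ∧
      ∀ (d r n m : ℕ) (M : RobustClustering.SubGaussianMixture d r)
        (Ω : Type*) [MeasurableSpace Ω] (P : Measure Ω) [IsProbabilityMeasure P]
        (φ : Fin n → Ω → Fin r) (y : Fin n → Ω → RobustClustering.Pt d)
        (z : Fin m → Ω → RobustClustering.Pt d) (θ γ κ₁ κ₂ : ℝ),
        M.IsSample P φ y →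
        (∃ k l, k ≠ l ∧ M.sepThreshold ≤ M.sep k l) →
        M.maxWeakSep < min (RobustClustering.cTilde * M.minWellSep) M.sepThreshold →
        0 < κ₁ → κ₁ * M.minWellSep ≤ θ → θ ≤ κ₂ * M.minWellSep →
        Real.exp (-M.minWellSep ^ 2 / (4 * θ ^ 2)) < γ →
        γ < Real.exp (-5 * M.minWellSep ^ 2 / (32 * θ ^ 2)) →
        ∀ c : Fin n → Fin r, r < RobustClustering.minClusterSize c →
          (ProbabilityTheory.cond P {ω | ∀ i, φ i ω = c i})
            {ω | ¬ ∀ X : Matrix (Fin n ⊕ Fin m) (Fin n ⊕ Fin m) ℝ,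
              RobustClustering.IsRobustLPSolution
                (RobustClustering.kernelMatrix θ
                  (Sum.elim (fun i => y i ω) (fun j => z j ω))) γ X →
              RobustClustering.l1Norm (RobustClustering.inlierPart X
                  - RobustClustering.inlierPart (M.mergedMatrix m c))
                ≤ C * (n : ℝ) ^ 2 * max M.errorRate
                    (Real.log (RobustClustering.minClusterSize c)
                      / RobustClustering.minClusterSize c) ∧
              (m < n →
                RobustClustering.l1Norm (X - M.mergedMatrix m c)
                    / RobustClustering.l1Norm (M.mergedMatrix m c)
                  ≤ C' * r * M.errorRate
                    + C'' * r * max (Real.log (RobustClustering.minClusterSize c)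
                        / RobustClustering.minClusterSize c) ((m : ℝ) / n))}
            ≤ ENNReal.ofReal (2 * r / RobustClustering.minClusterSize c) := by
  -- `6 = 2·(2 + 1)`: the count is at most `2n²p + n log N`, doubled for ordered pairs; `9 = 6 + 3`
  -- includes the outlier blocks.
  refine ⟨6, 6, 9, by norm_num, by norm_num, by norm_num, ?_⟩
  intro d r n m M Ω _ P _ φ y z θ γ κ₁ κ₂ hS hwell hmin hκ hθ₁ _ hγ₁ hγ₂ c hc
  obtain ⟨k, -⟩ := id hwell
  have hw := hmin.trans_le (min_le_left _ _)
  have hD := M.minWellSep_pos hw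
  have hθ : 0 < θ := (mul_pos hκ hD).trans_le hθ₁
  -- On a null label event the conditional measure is zero by convention.
  by_cases hPc : P {ω | ∀ i, φ i ω = c i} = 0
  · rw [cond_eq_zero_of_meas_eq_zero hPc]
    simp
  have hQ := cond_isProbabilityMeasure hPc
  set N := RobustClustering.minClusterSize c with hN
  have hr : (1 : ℝ) ≤ r := by exact_mod_cast k.pos
  have hN1 : 1 ≤ N := k.pos.trans hc
  have hNn : N ≤ n := RobustClustering.minClusterSize_le c k
  have hn : 0 < n := hN1.trans hNn
  have hN1' : (1 : ℝ) ≤ N := by exact_mod_cast hN1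
  have hNn' : (N : ℝ) ≤ n := by exact_mod_cast hNn
  have hn' : (0 : ℝ) < n := by exact_mod_cast hn
  have hlog : 0 ≤ Real.log N := Real.log_nonneg hN1'
  have hp : 0 ≤ M.errorRate := (Real.exp_pos _).le
  -- With `a = log N` the failure probability is `1/N`, below `2r/N` since `r ≥ 1`.
  have hconc := RobustClustering.measure_pair_count_ge_le hn hS.measurable_point
    (hS.iIndepFun_cond hPc) (A := fun e => M.atypicalPairs (c e.1) (c e.2))
    (fun e => M.measurableSet_atypicalPairs _ _) hp
    (fun e he => hS.measure_atypical_le hPc hwell hw he.ne) (Real.log N)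
  refine (measure_mono fun ω hω => ?_).trans
    (hconc.trans (ENNReal.ofReal_le_ofReal ?_))
  · by_contra hlt
    refine hω fun X hX => ?_
    rw [Set.mem_ofPred_eq, not_le] at hlt
    have hin : RobustClustering.l1Norm (RobustClustering.inlierPart X
        - RobustClustering.inlierPart (M.mergedMatrix m c))
        ≤ 6 * (n : ℝ) ^ 2 * max M.errorRate (Real.log N / N) := by
      have h1 := RobustClustering.SubGaussianMixture.l1Norm_inlierPart_sub_le (c := c)
        hD hθ hγ₁ hγ₂ hX
      have h2 : n * Real.log N ≤ n ^ 2 * (Real.log N / N) := by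
        rw [mul_div_assoc', le_div_iff₀ (by linarith)]
        nlinarith [mul_nonneg hn'.le hlog]
      have h3 : (n : ℝ) ^ 2 * M.errorRate ≤ n ^ 2 * max M.errorRate (Real.log N / N) :=
        mul_le_mul_of_nonneg_left (le_max_left _ _) (by positivity)
      have h4 : (n : ℝ) ^ 2 * (Real.log N / N) ≤ n ^ 2 * max M.errorRate (Real.log N / N) :=
        mul_le_mul_of_nonneg_left (le_max_right _ _) (by positivity)
      linarith
    exact ⟨hin, fun hmn => RobustClustering.SubGaussianMixture.l1Norm_sub_div_le hn hmn hX.1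
      (by positivity) hp hin⟩
  · rw [Real.exp_neg, Real.exp_log (by linarith), ← one_div]
    exact div_le_div_of_nonneg_right (by linarith) (by linarith)
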